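/- Let $B_n(x)\in\mathbb{Q}[x]$ be the $n$th Bernoulli polynomial, $\frac{te^{xt}}{e^t-1}=\sum_{n\ge 0}B_n(x)\frac{t^n}{n!}$, and $B_n=B_n(0)$ the $n$th Bernoulli number. For $f\in\mathbb{Q}[x]$ let $\operatorname{denom}(f)$ be the smallest positive integer $d$ such that $d\cdot f\in\mathbb{Z}[x]$ (for a rational number this is its usual denominator). For integers $n\ge 1$, $m\ge 1$ and $r\ge 0$ let $$S^n_{m,r}(x)=\frac{m^n}{n+1}\left(B_{n+1}\left(x+\frac rm\right)-B_{n+1}\left(\frac rm\right)\right)\in\mathbb{Q}[x],$$ which is the unique polynomial satisfying $S^n_{m,r}(x)=\sum_{k=0}^{x-1}(km+r)^n$ for all positive integers $x$. For $n\ge 1$ put $$\mathfrak{B}_n=\operatorname{denom}(B_n(x)),\qquad \mathfrak{D}_n=\operatorname{denom}(B_n(x)-B_n),\qquad D_n=\operatorname{denom}(B_n),$$ and let $\operatorname{rad}(k)=\prod_{p\mid k}p$ be the product of the primes dividing $k$. Then, for every $n\ge 1$: 1. for all integers $m\ge 1$ and $r\ge 0$, $S^n_{m,r}(x)\in\mathbb{Z}[x]$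 if and only if $\mathfrak{B}_n\mid m$; 2. $\mathfrak{B}_n=\operatorname{lcm}(\mathfrak{D}_n,D_n)$; 3. $\mathfrak{B}_n=\operatorname{lcm}(\mathfrak{D}_{n+1},\operatorname{rad}(n+1))$. -/

import Mathlib

open Polynomial

/-- `f ∈ ℤ[x]`, for a polynomial `f` with rational coefficients. -/
def HasIntCoeffs (f : ℚ[X]) : Prop :=
  ∃ g : ℤ[X], g.map (Int.castRingHom ℚ) = f

/-- The denominator of `f ∈ ℚ[x]`: the smallest positive integer `d` with `d · f ∈ ℤ[x]`. -/
noncomputable def polyDenom (f : ℚ[X]) : ℕ :=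
  sInf {d : ℕ | 0 < d ∧ HasIntCoeffs (C (d : ℚ) * f)}

/-- The infimum in `polyDenom` is taken over a nonempty set, hence is a minimum. -/
theorem polyDenom_spec (f : ℚ[X]) :
    0 < polyDenom f ∧ HasIntCoeffs (C (polyDenom f : ℚ) * f) := by
  have h : {d : ℕ | 0 < d ∧ HasIntCoeffs (C (d : ℚ) * f)}.Nonempty := by
    obtain ⟨b, hbM, hb⟩ := IsLocalization.integerNormalization_spec (nonZeroDivisors ℤ) f
    have hb0 : b ≠ 0 := nonZeroDivisors.ne_zero hbM
    have hb' : (IsLocalization.integerNormalization (nonZeroDivisors ℤ) f).map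
        (Int.castRingHom ℚ) = C (b : ℚ) * f := by
      have := hb
      rw [show algebraMap ℤ ℚ = Int.castRingHom ℚ from rfl] at this
      rw [this, ← smul_eq_C_mul, Int.cast_smul_eq_zsmul]
    refine ⟨b.natAbs, Int.natAbs_pos.mpr hb0, ?_⟩
    rcases Int.natAbs_eq b with h | h
    · refine ⟨_, hb'.trans ?_⟩
      rw [← Int.cast_natCast (R := ℚ), ← h]
    · refine ⟨-(IsLocalization.integerNormalization (nonZeroDivisors ℤ) f), ?_⟩
      have e : ((b.natAbs : ℕ) : ℚ) = -(b : ℚ) := by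
        rw [← Int.cast_natCast (R := ℚ), ← Int.cast_neg]
        congr 1
        omega
      rw [Polynomial.map_neg, hb', e, C_neg, neg_mul]
  exact Nat.sInf_mem h

/-- The polynomial `S^n_{m,r}(x)` that represents, for positive integers `x`, the power sum
`r ^ n + (m + r) ^ n + ⋯ + ((x - 1) m + r) ^ n` of an arithmetic progression, i.e.
`m ^ n / (n + 1) * (B_{n+1}(x + r / m) - B_{n+1}(r / m))`. -/
noncomputable def apPowerSum (m r n : ℕ) : ℚ[X] :=
  C ((m : ℚ) ^ n / ((n : ℚ) + 1)) *
    ((Polynomial.bernoulli (n + 1)).comp (X + C ((r : ℚ) / m)) -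
      C ((Polynomial.bernoulli (n + 1)).eval ((r : ℚ) / m)))

/-- `apPowerSum m r n` takes the values of the power sum. -/
theorem apPowerSum_eval (m r n : ℕ) (hm : 1 ≤ m) (x : ℕ) :
    (apPowerSum m r n).eval (x : ℚ) = ∑ k ∈ Finset.range x, ((k : ℚ) * m + r) ^ n := by
  have hm' : (m : ℚ) ≠ 0 := by positivity
  induction x with
  | zero => simp [apPowerSum]
  | succ x ih =>
    rw [Finset.sum_range_succ, ← ih]
    have h := Polynomial.bernoulli_eval_one_add (n + 1) ((x : ℚ) + r / m)
    have e : (x : ℚ) * m + r = m * (x + r / m) := by field_simp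
    rw [e, mul_pow]
    simp only [apPowerSum, eval_mul, eval_C, eval_sub, eval_comp, eval_add, eval_X]
    rw [show ((x + 1 : ℕ) : ℚ) + r / m = 1 + (x + r / m) by push_cast; ring, h]
    have : (n : ℚ) + 1 ≠ 0 := by positivity
    push_cast
    field_simp
    ring

/-- `apPowerSum m r n` is the only polynomial with the values of the power sum. -/
theorem apPowerSum_unique (m r n : ℕ) (hm : 1 ≤ m) (P : ℚ[X])
    (hP : ∀ x : ℕ, 1 ≤ x → P.eval (x : ℚ) = ∑ k ∈ Finset.range x, ((k : ℚ) * m + r) ^ n) :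
    P = apPowerSum m r n := by
  refine Polynomial.eq_of_infinite_eval_eq _ _
    (((Set.Ici_infinite 1).image (Nat.cast_injective (R := ℚ)).injOn).mono ?_)
  rintro _ ⟨x, hx, rfl⟩
  exact (hP x hx).trans (apPowerSum_eval m r n hm x).symm

/-- `𝔅_n`, the denominator of the Bernoulli polynomial `B_n(x)`. -/
noncomputable def bernoulliPolyDenom (n : ℕ) : ℕ :=
  polyDenom (Polynomial.bernoulli n)

/-- `𝔇_n`, the denominator of `B_n(x) - B_n`. -/
noncomputable def bernoulliPolyDiffDenom (n : ℕ) : ℕ :=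
  polyDenom (Polynomial.bernoulli n - C (_root_.bernoulli n))

/-- `D_n`, the denominator of the Bernoulli number `B_n` (with `B_1 = -1/2`). -/
def bernoulliDenom (n : ℕ) : ℕ :=
  (_root_.bernoulli n).den

/-- `rad(k)`, the product of the primes that divide `k`. -/
def natRad (k : ℕ) : ℕ :=
  ∏ p ∈ k.primeFactors, p

/-! ### Denominators of rational numbers and polynomials -/

/-! Everything is checked one prime at a time. By von Staudt–Clausen the `D_k` are squarefree, hence
so are `𝔅_n` and `𝔇_n`, and `p ∣ 𝔅_n` means that some `k ≤ n` has `p ∣ D_k` and `p ∤ n.choose k`;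
for `𝔇_n` the index `k = n` is dropped.

The formula with `rad (n + 1)` compares such witnesses for `n` and `n + 1`. The hard direction,
`Nat.Prime.dvd_bernoulliPolyDenom_of_dvd_diffDenom_succ`, uses Lucas' theorem to repair a witness
that fails for `n`.

For the power sum, a prime `p ∣ m` never obstructs: the powers of `m` absorb all denominators. If `p
∤ m`, differentiating and shifting back recovers `B_n(x)`, so `p ∤ 𝔅_n` is necessary; it suffices
because it yields `p ∤ n + 1` and `p ∤ 𝔇_{n+1}`. -/

theorem Rat.den_dvd_iff_mul_eq_intCast {a : ℚ} {d : ℕ} :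
    a.den ∣ d ↔ ∃ z : ℤ, (z : ℚ) = d * a := by
  constructor
  · rintro ⟨e, rfl⟩
    refine ⟨e * a.num, ?_⟩
    push_cast
    rw [mul_right_comm, mul_comm (a.den : ℚ) a, Rat.mul_den_eq_num, mul_comm]
  · rintro ⟨z, hz⟩
    rcases eq_or_ne d 0 with rfl | hd
    · exact dvd_zero _
    · have hd' : (d : ℚ) ≠ 0 := by exact_mod_cast hd
      have ha : a = Rat.divInt z d := by
        rw [Rat.divInt_eq_div, eq_div_iff (by exact_mod_cast hd'), hz]
        push_cast
        ring
      rw [ha]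
      exact_mod_cast Rat.den_dvd z d

theorem hasIntCoeffs_iff_den_coeff_dvd_one {f : ℚ[X]} :
    HasIntCoeffs f ↔ ∀ i, (f.coeff i).den ∣ 1 := by
  have h : HasIntCoeffs f ↔ f ∈ lifts (Int.castRingHom ℚ) := by
    rw [HasIntCoeffs, mem_lifts]
  rw [h, lifts_iff_coeff_lifts]
  refine forall_congr' fun i => ?_
  rw [Rat.den_dvd_iff_mul_eq_intCast]
  simp

theorem hasIntCoeffs_C_mul_iff {f : ℚ[X]} {d : ℕ} :
    HasIntCoeffs (C (d : ℚ) * f) ↔ ∀ i, (f.coeff i).den ∣ d := by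
  rw [hasIntCoeffs_iff_den_coeff_dvd_one]
  refine forall_congr' fun i => ?_
  rw [Rat.den_dvd_iff_mul_eq_intCast, Rat.den_dvd_iff_mul_eq_intCast]
  simp

theorem polyDenom_dvd_iff {f : ℚ[X]} {d : ℕ} :
    polyDenom f ∣ d ↔ ∀ i, (f.coeff i).den ∣ d := by
  have hspec := hasIntCoeffs_C_mul_iff.mp (polyDenom_spec f).2
  refine ⟨fun h i => (hspec i).trans h, fun h => ?_⟩
  rw [Nat.dvd_iff_mod_eq_zero]
  by_contra hne
  -- The remainder would be a smaller admissible multiplier than the minimum.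
  have hmem : d % polyDenom f ∈ {d : ℕ | 0 < d ∧ HasIntCoeffs (C (d : ℚ) * f)} :=
    ⟨Nat.pos_of_ne_zero hne, hasIntCoeffs_C_mul_iff.mpr fun i =>
      (Nat.dvd_mod_iff (hspec i)).mpr (h i)⟩
  exact absurd (Nat.sInf_le hmem) (not_le.mpr (Nat.mod_lt _ (polyDenom_spec f).1))

theorem den_coeff_dvd_polyDenom (f : ℚ[X]) (i : ℕ) : (f.coeff i).den ∣ polyDenom f :=
  polyDenom_dvd_iff.mp dvd_rfl i

theorem Nat.Prime.dvd_polyDenom_iff {p : ℕ} (hp : p.Prime) {f : ℚ[X]} :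
    p ∣ polyDenom f ↔ ∃ i, p ∣ (f.coeff i).den := by
  refine ⟨fun ⟨e, he⟩ => ?_, fun ⟨i, hi⟩ => hi.trans (den_coeff_dvd_polyDenom f i)⟩
  by_contra! hno
  have hpos := (polyDenom_spec f).1
  -- With no `p` in any coefficient denominator, the cofactor `e` already clears them all.
  have hdvd : polyDenom f ∣ e := polyDenom_dvd_iff.mpr fun i =>
    ((hp.coprime_iff_not_dvd.mpr (hno i)).symm).dvd_of_dvd_mul_left
      (he ▸ den_coeff_dvd_polyDenom f i)
  have he0 : 0 < e := Nat.pos_of_ne_zero fun h => by simp [h] at he; omega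
  have := Nat.le_of_dvd he0 hdvd
  have := hp.two_le
  nlinarith

theorem Squarefree.dvd_of_forall_prime_dvd {a b : ℕ} (ha : Squarefree a) (hb : b ≠ 0)
    (h : ∀ p : ℕ, p.Prime → p ∣ a → p ∣ b) : a ∣ b := by
  rw [← Nat.prod_primeFactors_of_squarefree ha]
  refine (Finset.prod_dvd_prod_of_subset _ b.primeFactors _ fun p hp => ?_).trans
    (Nat.prod_primeFactors_dvd b)
  have := Nat.prime_of_mem_primeFactors hp
  exact Nat.mem_primeFactors.mpr ⟨this, h p this (Nat.dvd_of_mem_primeFactors hp), hb⟩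

theorem squarefree_natRad (k : ℕ) : Squarefree (natRad k) := by
  rw [natRad, ← Nat.radical_eq_prod_primeFactors]
  exact UniqueFactorizationMonoid.squarefree_radical

theorem Nat.Prime.dvd_natRad_iff {p k : ℕ} (hp : p.Prime) (hk : k ≠ 0) :
    p ∣ natRad k ↔ p ∣ k := by
  rw [natRad, ← Nat.radical_eq_prod_primeFactors]
  exact UniqueFactorizationMonoid.dvd_radical_iff_of_irreducible hp hk

theorem squarefree_polyDenom {f : ℚ[X]} (h : ∀ i, Squarefree (f.coeff i).den) :
    Squarefree (polyDenom f) := by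
  refine (squarefree_natRad (polyDenom f)).squarefree_of_dvd (polyDenom_dvd_iff.mpr fun i => ?_)
  refine (h i).dvd_of_forall_prime_dvd (squarefree_natRad _).ne_zero fun p hp hpd => ?_
  exact (hp.dvd_natRad_iff (polyDenom_spec f).1.ne').mpr
    (hpd.trans (den_coeff_dvd_polyDenom f i))

/-! ### Rational numbers and polynomials that are integral at a prime -/

/-- The subring of `p`-integral rational numbers. -/
noncomputable def pIntegers (p : ℕ) [Fact p.Prime] : Subring ℚ := (Rat.padicValuation p).integer

theorem mem_pIntegers {p : ℕ} [Fact p.Prime] {x : ℚ} : x ∈ pIntegers p ↔ ¬ p ∣ x.den :=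
  Rat.padicValuation_le_one_iff

theorem mul_mem_pIntegers_iff_of_not_dvd {p : ℕ} [hp : Fact p.Prime] {c : ℕ} (hc : ¬ p ∣ c)
    {x : ℚ} : (c : ℚ) * x ∈ pIntegers p ↔ x ∈ pIntegers p := by
  refine ⟨fun h => ?_, fun h => mul_mem (natCast_mem _ c) h⟩
  rw [mem_pIntegers] at h ⊢
  intro hx
  obtain ⟨z, hz⟩ := Rat.den_dvd_iff_mul_eq_intCast.mp (dvd_refl ((c : ℚ) * x).den)
  have hd : x.den ∣ ((c : ℚ) * x).den * c :=
    Rat.den_dvd_iff_mul_eq_intCast.mpr ⟨z, by rw [hz]; push_cast; ring⟩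
  exact (hp.out.dvd_mul.mp (hx.trans hd)).elim h hc

/-- A squarefree denominator contains `p` at most once, so a single factor `p` clears it. -/
theorem mul_mem_pIntegers_of_dvd {p : ℕ} [hp : Fact p.Prime] {c : ℕ} (hc : p ∣ c)
    {x : ℚ} (hx : Squarefree x.den) : (c : ℚ) * x ∈ pIntegers p := by
  by_cases hpx : p ∣ x.den
  · obtain ⟨e, he⟩ := hpx
    obtain ⟨b, rfl⟩ := hc
    obtain ⟨z, hz⟩ := Rat.den_dvd_iff_mul_eq_intCast.mp (dvd_refl x.den)
    rw [mem_pIntegers]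
    intro hpd
    have hd : (((p * b : ℕ) : ℚ) * x).den ∣ e :=
      Rat.den_dvd_iff_mul_eq_intCast.mpr ⟨b * z, by rw [Int.cast_mul, hz, he]; push_cast; ring⟩
    have : p * p ∣ x.den := he ▸ mul_dvd_mul_left p (hpd.trans hd)
    exact Nat.squarefree_iff_prime_squarefree.mp hx p hp.out this
  · exact mul_mem (natCast_mem _ c) (mem_pIntegers.mpr hpx)

theorem inv_natCast_mem_pIntegers {p : ℕ} [hp : Fact p.Prime] {c : ℕ} (hc : ¬ p ∣ c) :
    (c : ℚ)⁻¹ ∈ pIntegers p := by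
  have hc0 : (c : ℚ) ≠ 0 := by
    rintro h
    exact hc (by simp [Nat.cast_eq_zero.mp h])
  rw [← mul_mem_pIntegers_iff_of_not_dvd hc, mul_inv_cancel₀ hc0]
  exact one_mem _

/-- A power `m ^ l` with `p ∣ m` absorbs the `p`-part of the denominator `l + 1`. -/
theorem pow_div_succ_mem_pIntegers {p : ℕ} [hp : Fact p.Prime] {m : ℕ} (hm : p ∣ m) (l : ℕ) :
    (m : ℚ) ^ l / ((l : ℚ) + 1) ∈ pIntegers p := by
  have he : (l + 1).factorization p ≤ l := Nat.lt_succ_iff.mp (Nat.factorization_lt p l.succ_ne_zero)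
  set e := (l + 1).factorization p
  set u := (l + 1) / p ^ e
  have hu : ¬ p ∣ u := Nat.not_dvd_ordCompl hp.out l.succ_ne_zero
  have hfac : p ^ e * u = l + 1 := Nat.ordProj_mul_ordCompl_eq_self (l + 1) p
  obtain ⟨w, hw⟩ : p ^ e ∣ m ^ l := (pow_dvd_pow p he).trans (pow_dvd_pow_of_dvd hm l)
  have hp0 : (p : ℚ) ≠ 0 := by exact_mod_cast hp.out.ne_zero
  have h1 : (m : ℚ) ^ l = (p : ℚ) ^ e * w := by exact_mod_cast hw
  have h2 : (l : ℚ) + 1 = (p : ℚ) ^ e * u := by exact_mod_cast hfac.symm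
  rw [h1, h2, mul_div_mul_left _ _ (pow_ne_zero _ hp0), div_eq_mul_inv]
  exact mul_mem (natCast_mem _ w) (inv_natCast_mem_pIntegers hu)

/-- The subring of rational polynomials with `p`-integral coefficients. -/
noncomputable def pIntegralPolys (p : ℕ) [Fact p.Prime] : Subring ℚ[X] :=
  (mapRingHom (pIntegers p).subtype).range

theorem mem_pIntegralPolys {p : ℕ} [Fact p.Prime] {f : ℚ[X]} :
    f ∈ pIntegralPolys p ↔ ∀ i, f.coeff i ∈ pIntegers p := by
  rw [pIntegralPolys, mem_map_range, Subring.range_subtype]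

theorem not_dvd_polyDenom_iff {p : ℕ} [hp : Fact p.Prime] {f : ℚ[X]} :
    ¬ p ∣ polyDenom f ↔ f ∈ pIntegralPolys p := by
  rw [hp.out.dvd_polyDenom_iff, mem_pIntegralPolys, not_exists]
  exact forall_congr' fun i => mem_pIntegers.symm

theorem hasIntCoeffs_of_forall_prime {f : ℚ[X]}
    (h : ∀ (p : ℕ) [Fact p.Prime], f ∈ pIntegralPolys p) : HasIntCoeffs f := by
  rw [hasIntCoeffs_iff_den_coeff_dvd_one]
  intro i
  rw [Nat.dvd_one, Nat.eq_one_iff_not_exists_prime_dvd]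
  intro p hp
  have : Fact p.Prime := ⟨hp⟩
  exact mem_pIntegers.mp (mem_pIntegralPolys.mp (h p) i)

theorem HasIntCoeffs.mem_pIntegralPolys {f : ℚ[X]} (hf : HasIntCoeffs f) (p : ℕ)
    [hp : Fact p.Prime] : f ∈ pIntegralPolys p := by
  rw [_root_.mem_pIntegralPolys]
  intro i
  rw [mem_pIntegers, Nat.dvd_one.mp (hasIntCoeffs_iff_den_coeff_dvd_one.mp hf i), Nat.dvd_one]
  exact hp.out.ne_one

theorem C_mem_pIntegralPolys {p : ℕ} [Fact p.Prime] {a : ℚ} (ha : a ∈ pIntegers p) :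
    C a ∈ pIntegralPolys p :=
  ⟨C ⟨a, ha⟩, by simp⟩

theorem X_mem_pIntegralPolys {p : ℕ} [Fact p.Prime] : (X : ℚ[X]) ∈ pIntegralPolys p :=
  ⟨X, by simp⟩

theorem comp_mem_pIntegralPolys {p : ℕ} [Fact p.Prime] {f g : ℚ[X]} (hf : f ∈ pIntegralPolys p)
    (hg : g ∈ pIntegralPolys p) : f.comp g ∈ pIntegralPolys p := by
  obtain ⟨f, rfl⟩ := hf
  obtain ⟨g, rfl⟩ := hg
  exact ⟨f.comp g, by simp [Polynomial.map_comp]⟩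

theorem derivative_mem_pIntegralPolys {p : ℕ} [Fact p.Prime] {f : ℚ[X]}
    (hf : f ∈ pIntegralPolys p) : derivative f ∈ pIntegralPolys p := by
  obtain ⟨f, rfl⟩ := hf
  exact ⟨derivative f, by simp [Polynomial.derivative_map]⟩

theorem eval_mem_pIntegers {p : ℕ} [Fact p.Prime] {f : ℚ[X]} (hf : f ∈ pIntegralPolys p)
    {a : ℚ} (ha : a ∈ pIntegers p) : f.eval a ∈ pIntegers p := by
  rw [eval_eq_sum_range]
  exact sum_mem fun i _ => mul_mem (mem_pIntegralPolys.mp hf i) (pow_mem ha i)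

/-! ### Denominators of Bernoulli numbers -/

theorem bernoulli_two_mul_den_dvd (k : ℕ) : (_root_.bernoulli (2 * k)).den ∣
    ∏ q ∈ Finset.range (2 * k + 2) with q.Prime ∧ (q - 1) ∣ 2 * k, q := by
  obtain ⟨z, hz⟩ := Bernoulli.vonStaudt_clausen k
  rw [← sub_eq_iff_eq_add] at hz
  rw [← hz]
  refine (Rat.sub_den_dvd _ _).trans ?_
  rw [Rat.den_intCast, one_mul]
  refine (Finset.Rat.den_sum_dvd_prod_den _ _).trans (dvd_of_eq (Finset.prod_congr rfl ?_))
  intro q hq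
  simp [(Finset.mem_filter.mp hq).2.1.ne_zero]

theorem squarefree_bernoulliDenom (k : ℕ) : Squarefree (bernoulliDenom k) := by
  rw [bernoulliDenom]
  rcases Nat.even_or_odd' k with ⟨t, rfl | rfl⟩
  · refine Squarefree.squarefree_of_dvd (bernoulli_two_mul_den_dvd t) ?_
    rw [← Nat.primeFactors_prod
      (s := (Finset.range (2 * t + 2)).filter fun q => q.Prime ∧ (q - 1) ∣ 2 * t)
      fun q hq => (Finset.mem_filter.mp hq).2.1]
    exact squarefree_natRad _
  · rcases Nat.eq_zero_or_pos t with rfl | ht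
    · have : (_root_.bernoulli (2 * 0 + 1)).den = 2 := by norm_num [_root_.bernoulli_one]
      rw [this]
      exact Nat.prime_two.prime.squarefree
    · rw [bernoulli_eq_zero_of_odd ⟨t, rfl⟩ (by omega)]
      simp

theorem Nat.Prime.sub_one_dvd_of_dvd_bernoulliDenom {p : ℕ} (hp : p.Prime) {k : ℕ}
    (h : p ∣ bernoulliDenom k) : (p - 1) ∣ k := by
  rw [bernoulliDenom] at h
  rcases Nat.even_or_odd' k with ⟨t, rfl | rfl⟩
  · obtain ⟨q, hq, hpq⟩ := (hp.prime.dvd_finsetProd_iff _).mp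
      (h.trans (bernoulli_two_mul_den_dvd t))
    obtain ⟨-, hq, hqt⟩ := Finset.mem_filter.mp hq
    rwa [(Nat.prime_dvd_prime_iff_eq hp hq).mp hpq]
  · rcases Nat.eq_zero_or_pos t with rfl | ht
    · have : (_root_.bernoulli (2 * 0 + 1)).den = 2 := by norm_num [_root_.bernoulli_one]
      rw [this, Nat.prime_dvd_prime_iff_eq hp Nat.prime_two] at h
      simp [h]
    · rw [bernoulli_eq_zero_of_odd ⟨t, rfl⟩ (by omega)] at h
      exact absurd (Nat.dvd_one.mp h) hp.ne_one

theorem Nat.Prime.dvd_bernoulliDenom {p : ℕ} (hp : p.Prime) {k : ℕ} (hk : k ≠ 0)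
    (hk' : k = 1 ∨ Even k) (h : (p - 1) ∣ k) : p ∣ bernoulliDenom k := by
  have : Fact p.Prime := ⟨hp⟩
  rcases hk' with rfl | hk'
  · have hp2 : p = 2 := by have := Nat.dvd_one.mp h; omega
    norm_num [bernoulliDenom, _root_.bernoulli_one, hp2]
  · obtain ⟨t, rfl⟩ := even_iff_two_dvd.mp hk'
    by_contra hcon
    have hB : _root_.bernoulli (2 * t) ∈ pIntegers p := mem_pIntegers.mpr hcon
    have hmem : p ∈ (Finset.range (2 * t + 2)).filter fun q => q.Prime ∧ (q - 1) ∣ 2 * t := by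
      have := Nat.le_of_dvd (Nat.pos_of_ne_zero hk) h
      exact Finset.mem_filter.mpr ⟨Finset.mem_range.mpr (by omega), hp, h⟩
    obtain ⟨z, hz⟩ := Bernoulli.vonStaudt_clausen t
    rw [← Finset.add_sum_erase _ _ hmem] at hz
    have hrest : ∑ q ∈ ((Finset.range (2 * t + 2)).filter
        fun q => q.Prime ∧ (q - 1) ∣ 2 * t).erase p, (1 : ℚ) / q ∈ pIntegers p := by
      refine sum_mem fun q hq => ?_
      obtain ⟨hqp, hq⟩ := Finset.mem_erase.mp hq
      rw [one_div]
      exact inv_natCast_mem_pIntegers fun hdvd =>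
        hqp ((Nat.prime_dvd_prime_iff_eq hp (Finset.mem_filter.mp hq).2.1).mp hdvd).symm
    -- In the von Staudt–Clausen sum only the term `1 / p` can fail to be `p`-integral; integrality
    -- of `B_{2t}` would force it to be so as well.
    have hinv : (1 : ℚ) / p ∈ pIntegers p := by
      have := sub_mem (sub_mem (intCast_mem (pIntegers p) z) hB) hrest
      rw [hz] at this
      convert this using 1
      ring
    rw [mem_pIntegers] at hinv
    exact hinv (by simp [hp.ne_zero])

/-! ### Denominators of Bernoulli polynomials -/

theorem bernoulli_mul_natCast_mem_pIntegers_iff {p : ℕ} [Fact p.Prime] (c k : ℕ) :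
    _root_.bernoulli k * c ∈ pIntegers p ↔ (p ∣ bernoulliDenom k → p ∣ c) := by
  rw [mul_comm]
  by_cases hc : p ∣ c
  · simp only [hc, implies_true, iff_true]
    exact mul_mem_pIntegers_of_dvd hc (squarefree_bernoulliDenom k)
  · rw [mul_mem_pIntegers_iff_of_not_dvd hc, mem_pIntegers, bernoulliDenom]
    simp [hc]

theorem Nat.Prime.dvd_bernoulliPolyDenom_iff {p : ℕ} (hp : p.Prime) {n : ℕ} :
    p ∣ bernoulliPolyDenom n ↔ ∃ k ≤ n, p ∣ bernoulliDenom k ∧ ¬ p ∣ n.choose k := by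
  have : Fact p.Prime := ⟨hp⟩
  rw [← not_iff_not, bernoulliPolyDenom, not_dvd_polyDenom_iff, mem_pIntegralPolys]
  push Not
  constructor
  · intro h k hk
    have := h (n - k)
    rw [coeff_bernoulli, if_pos (Nat.sub_le n k), Nat.sub_sub_self hk, Nat.choose_symm hk,
      bernoulli_mul_natCast_mem_pIntegers_iff] at this
    exact this
  · intro h i
    rw [coeff_bernoulli]
    split_ifs with hi
    · rw [bernoulli_mul_natCast_mem_pIntegers_iff, ← Nat.choose_symm hi]
      exact h _ (Nat.sub_le n i)
    · exact zero_mem _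

theorem coeff_bernoulli_sub_C (n i : ℕ) :
    (Polynomial.bernoulli n - C (_root_.bernoulli n)).coeff i =
      if i = 0 then 0 else (Polynomial.bernoulli n).coeff i := by
  rw [coeff_sub, coeff_C]
  split_ifs with hi
  · simp [hi, coeff_bernoulli]
  · simp

theorem Nat.Prime.dvd_bernoulliPolyDiffDenom_iff {p : ℕ} (hp : p.Prime) {n : ℕ} :
    p ∣ bernoulliPolyDiffDenom n ↔ ∃ k < n, p ∣ bernoulliDenom k ∧ ¬ p ∣ n.choose k := by
  have : Fact p.Prime := ⟨hp⟩
  rw [← not_iff_not, bernoulliPolyDiffDenom, not_dvd_polyDenom_iff, mem_pIntegralPolys]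
  push Not
  constructor
  · intro h k hk
    have := h (n - k)
    rw [coeff_bernoulli_sub_C, if_neg (by omega), coeff_bernoulli, if_pos (Nat.sub_le n k),
      Nat.sub_sub_self hk.le, Nat.choose_symm hk.le,
      bernoulli_mul_natCast_mem_pIntegers_iff] at this
    exact this
  · intro h i
    rw [coeff_bernoulli_sub_C, coeff_bernoulli]
    split_ifs with h0 hi
    · exact zero_mem _
    · rw [bernoulli_mul_natCast_mem_pIntegers_iff, ← Nat.choose_symm hi]
      exact h _ (by omega)
    · exact zero_mem _

theorem squarefree_den_coeff_bernoulli (n i : ℕ) :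
    Squarefree ((Polynomial.bernoulli n).coeff i).den := by
  rw [coeff_bernoulli]
  split_ifs
  · refine (squarefree_bernoulliDenom (n - i)).squarefree_of_dvd ((Rat.mul_den_dvd _ _).trans ?_)
    simp [bernoulliDenom]
  · simp

theorem squarefree_bernoulliPolyDenom (n : ℕ) : Squarefree (bernoulliPolyDenom n) :=
  squarefree_polyDenom (squarefree_den_coeff_bernoulli n)

theorem squarefree_bernoulliPolyDiffDenom (n : ℕ) : Squarefree (bernoulliPolyDiffDenom n) := by
  refine squarefree_polyDenom fun i => ?_
  rw [coeff_bernoulli_sub_C]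
  split_ifs
  · simp
  · exact squarefree_den_coeff_bernoulli n i

theorem bernoulliPolyDenom_eq_lcm_bernoulliDenom (n : ℕ) :
    bernoulliPolyDenom n = Nat.lcm (bernoulliPolyDiffDenom n) (bernoulliDenom n) := by
  have h0 : ((Polynomial.bernoulli n).coeff 0).den = bernoulliDenom n := by
    simp [coeff_bernoulli, bernoulliDenom]
  refine Nat.dvd_antisymm (polyDenom_dvd_iff.mpr fun i => ?_)
    (Nat.lcm_dvd (polyDenom_dvd_iff.mpr fun i => ?_) ?_)
  · rcases eq_or_ne i 0 with rfl | hi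
    · exact h0 ▸ Nat.dvd_lcm_right _ _
    · have := den_coeff_dvd_polyDenom (Polynomial.bernoulli n - C (_root_.bernoulli n)) i
      rw [coeff_bernoulli_sub_C, if_neg hi] at this
      exact this.trans (Nat.dvd_lcm_left _ _)
  · rw [coeff_bernoulli_sub_C]
    split_ifs
    · simp
    · exact den_coeff_dvd_polyDenom _ i
  · exact h0 ▸ den_coeff_dvd_polyDenom (Polynomial.bernoulli n) 0

/-! ### Base-`p` digits and the comparison of `𝔅_n` with `𝔇_{n+1}` -/

/-- One step of Lucas' theorem; a nonzero binomial coefficient with top entry below `p` divides a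
factorial prime to `p`. -/
theorem not_dvd_choose_iff_mod_div {p : ℕ} [hp : Fact p.Prime] (A B : ℕ) :
    ¬ p ∣ A.choose B ↔ B % p ≤ A % p ∧ ¬ p ∣ (A / p).choose (B / p) := by
  rw [(Choose.choose_modEq_choose_mod_mul_choose_div_nat (n := A) (k := B)).dvd_iff dvd_rfl,
    hp.out.dvd_mul, not_or]
  refine and_congr_left fun _ => ?_
  have hlt : A % p < p := Nat.mod_lt _ hp.out.pos
  constructor
  · intro h1
    by_contra h2
    exact h1 (by rw [Nat.choose_eq_zero_of_lt (not_le.mp h2)]; exact dvd_zero p)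
  · intro h1 h2
    have := (hp.out.dvd_factorial).mp (h2.trans
      ⟨_, by rw [← mul_assoc]; exact (Nat.choose_mul_factorial_mul_factorial h1).symm⟩)
    omega

/-- By Lucas' theorem a binomial coefficient `N.choose K` prime to `p` with `K < N` stays prime
to `p` when a suitable base-`p` digit of `K` is increased by one. -/
theorem exists_not_dvd_choose_add_pow {p : ℕ} [hp : Fact p.Prime] {N K : ℕ} (hK : K < N)
    (h : ¬ p ∣ N.choose K) : ∃ j, ¬ p ∣ N.choose (K + p ^ j) := by
  induction N using Nat.strong_induction_on generalizing K with
  | _ N ih =>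
    have hp1 := hp.out.one_lt
    obtain ⟨hmod, hdiv⟩ := (not_dvd_choose_iff_mod_div N K).mp h
    -- If the last digit of `K` is below that of `N`, raise it; if they agree, recurse on the
    -- quotients.
    rcases hmod.lt_or_eq with hlt | heq
    · refine ⟨0, (not_dvd_choose_iff_mod_div _ _).mpr ?_⟩
      have hNp : N % p < p := Nat.mod_lt _ hp.out.pos
      have hdm := Nat.div_add_mod K p
      have e : K + p ^ 0 = (K % p + 1) + p * (K / p) := by rw [pow_zero]; omega
      rw [e, Nat.add_mul_mod_self_left, Nat.add_mul_div_left _ _ hp.out.pos,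
        Nat.mod_eq_of_lt (by omega : K % p + 1 < p), Nat.div_eq_of_lt (by omega : K % p + 1 < p),
        zero_add]
      exact ⟨hlt, hdiv⟩
    · have hq : K / p < N / p := by
        by_contra! hle
        have h1 := Nat.div_add_mod K p
        have h2 := Nat.div_add_mod N p
        have := Nat.mul_le_mul_left p hle
        omega
      obtain ⟨j, hj⟩ := ih (N / p) (Nat.div_lt_self (by omega) hp1) hq hdiv
      refine ⟨j + 1, (not_dvd_choose_iff_mod_div _ _).mpr ?_⟩
      rw [pow_succ', Nat.add_mul_mod_self_left, Nat.add_mul_div_left _ _ hp.out.pos]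
      exact ⟨hmod, hj⟩

theorem two_dvd_bernoulliPolyDenom {n : ℕ} (hn : 1 ≤ n) : 2 ∣ bernoulliPolyDenom n := by
  rw [Nat.prime_two.dvd_bernoulliPolyDenom_iff]
  rcases Nat.even_or_odd n with h | h
  · exact ⟨n, le_rfl, Nat.prime_two.dvd_bernoulliDenom (by omega) (Or.inr h) (one_dvd n),
      by simp⟩
  · refine ⟨1, hn, Nat.prime_two.dvd_bernoulliDenom one_ne_zero (Or.inl rfl) (one_dvd 1), ?_⟩
    rw [Nat.choose_one_right]
    exact h.not_two_dvd_nat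

/-- The last base-`p` digit of `n` is `p - 1`, so `k = p - 1` is a witness. -/
theorem Nat.Prime.dvd_bernoulliPolyDenom_of_dvd_succ {p n : ℕ} (hp : p.Prime)
    (h : p ∣ n + 1) : p ∣ bernoulliPolyDenom n := by
  have : Fact p.Prime := ⟨hp⟩
  have hp2 := hp.two_le
  have hle := Nat.le_of_dvd n.succ_pos h
  have hmod : n % p = p - 1 := by
    obtain ⟨c, hc⟩ := h
    obtain ⟨c, rfl⟩ : ∃ d, c = d + 1 := ⟨c - 1, by
      have : c ≠ 0 := by rintro rfl; simp at hc
      omega⟩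
    have : n = (p - 1) + p * c := by rw [mul_add, mul_one] at hc; omega
    rw [this, Nat.add_mul_mod_self_left, Nat.mod_eq_of_lt (by omega)]
  refine hp.dvd_bernoulliPolyDenom_iff.mpr ⟨p - 1, by omega, ?_, ?_⟩
  · refine hp.dvd_bernoulliDenom (by omega) ?_ dvd_rfl
    rcases hp.eq_two_or_odd' with rfl | hodd
    · exact Or.inl rfl
    · exact Or.inr (Nat.Odd.sub_odd hodd odd_one)
  · rw [not_dvd_choose_iff_mod_div, hmod, Nat.mod_eq_of_lt (by omega : p - 1 < p),
      Nat.div_eq_of_lt (by omega : p - 1 < p), Nat.choose_zero_right]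
    exact ⟨le_rfl, hp.one_lt.ne' ∘ Nat.dvd_one.mp⟩

/-- If a witness `k` for `n + 1` fails for `n`, then `k` and `n + 1` share their last digit, which
is nonzero when `p ∤ n + 1`. Adding `p ^ (j + 1) - 1` lowers that digit by one, to match `n`, and
adds `p ^ j` to `k / p`; it also preserves divisibility by `p - 1`, so von Staudt–Clausen still
applies. -/
theorem Nat.Prime.dvd_bernoulliPolyDenom_of_dvd_diffDenom_succ {p n : ℕ} (hp : p.Prime)
    (hn : 1 ≤ n) (h : p ∣ bernoulliPolyDiffDenom (n + 1)) : p ∣ bernoulliPolyDenom n := by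
  have : Fact p.Prime := ⟨hp⟩
  rcases hp.eq_two_or_odd' with rfl | hodd
  · exact two_dvd_bernoulliPolyDenom hn
  by_cases hpn : p ∣ n + 1
  · exact hp.dvd_bernoulliPolyDenom_of_dvd_succ hpn
  obtain ⟨k, hk, hD, hc⟩ := hp.dvd_bernoulliPolyDiffDenom_iff.mp h
  rw [hp.dvd_bernoulliPolyDenom_iff]
  by_cases hkn : p ∣ n.choose k
  swap
  · exact ⟨k, by omega, hD, hkn⟩
  have hsub : p ∣ n + 1 - k := by
    have := Nat.choose_mul_succ_eq n k ▸ Dvd.dvd.mul_right hkn (n + 1)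
    exact (hp.dvd_mul.mp this).resolve_left hc
  have hp2 := hp.two_le
  have hmod : (n + 1) % p = k % p := ((Nat.modEq_iff_dvd' hk.le).mpr hsub).symm
  have ha : (n + 1) % p ≠ 0 := fun h0 => hpn (Nat.dvd_of_mod_eq_zero h0)
  have hap : (n + 1) % p < p := Nat.mod_lt _ hp.pos
  have h1 := Nat.div_add_mod (n + 1) p
  have h2 := Nat.div_add_mod k p
  have hKN : k / p < (n + 1) / p := by
    by_contra! hle
    have := Nat.mul_le_mul_left p hle
    omega
  obtain ⟨j, hj⟩ := exists_not_dvd_choose_add_pow hKN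
    ((not_dvd_choose_iff_mod_div _ _).mp hc).2
  have hpow : 1 ≤ p ^ (j + 1) := Nat.one_le_pow _ _ hp.pos
  set k' := k + (p ^ (j + 1) - 1) with hk'
  have ek : k' = ((n + 1) % p - 1) + p * (k / p + p ^ j) := by
    rw [mul_add, ← _root_.pow_succ' p j]
    omega
  have en : n = ((n + 1) % p - 1) + p * ((n + 1) / p) := by omega
  have hchoose : ¬ p ∣ n.choose k' := by
    have hlt : (n + 1) % p - 1 < p := by omega
    rw [not_dvd_choose_iff_mod_div]
    have k1 : k' % p = (n + 1) % p - 1 := by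
      rw [ek, Nat.add_mul_mod_self_left, Nat.mod_eq_of_lt hlt]
    have k2 : k' / p = k / p + p ^ j := by
      rw [ek, Nat.add_mul_div_left _ _ hp.pos, Nat.div_eq_of_lt hlt, zero_add]
    have n1 : n % p = (n + 1) % p - 1 := by
      conv_lhs => rw [en]
      rw [Nat.add_mul_mod_self_left, Nat.mod_eq_of_lt hlt]
    have n2 : n / p = (n + 1) / p := by
      conv_lhs => rw [en]
      rw [Nat.add_mul_div_left _ _ hp.pos, Nat.div_eq_of_lt hlt, zero_add]
    rw [k1, k2, n1, n2]
    exact ⟨le_rfl, hj⟩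
  have hdvd : (p - 1) ∣ k' := by
    refine dvd_add (hp.sub_one_dvd_of_dvd_bernoulliDenom hD) ?_
    simpa using Nat.sub_dvd_pow_sub_pow p 1 (j + 1)
  have heven : Even k' :=
    even_iff_two_dvd.mpr ((even_iff_two_dvd.mp (Nat.Odd.sub_odd hodd odd_one)).trans hdvd)
  refine ⟨k', ?_, hp.dvd_bernoulliDenom ?_ (Or.inr heven) hdvd, hchoose⟩
  · by_contra! hlt
    exact hchoose (by rw [Nat.choose_eq_zero_of_lt hlt]; exact dvd_zero p)
  · have : k % p ≠ 0 := hmod ▸ ha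
    have : k ≠ 0 := by rintro rfl; simp at this
    omega

theorem Nat.Prime.dvd_diffDenom_succ_or_dvd_succ {p n : ℕ} (hp : p.Prime)
    (h : p ∣ bernoulliPolyDenom n) : p ∣ bernoulliPolyDiffDenom (n + 1) ∨ p ∣ n + 1 := by
  obtain ⟨k, hk, hD, hc⟩ := hp.dvd_bernoulliPolyDenom_iff.mp h
  refine or_iff_not_imp_right.mpr fun hpn => ?_
  refine hp.dvd_bernoulliPolyDiffDenom_iff.mpr ⟨k, by omega, hD, fun hdvd => ?_⟩
  have := Nat.choose_mul_succ_eq n k ▸ Dvd.dvd.mul_right hdvd (n + 1 - k)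
  exact (hp.dvd_mul.mp this).elim hc hpn

theorem bernoulliPolyDenom_eq_lcm_natRad {n : ℕ} (hn : 1 ≤ n) :
    bernoulliPolyDenom n = Nat.lcm (bernoulliPolyDiffDenom (n + 1)) (natRad (n + 1)) := by
  have h0 : bernoulliPolyDenom n ≠ 0 := (squarefree_bernoulliPolyDenom n).ne_zero
  refine Nat.dvd_antisymm ?_ (Nat.lcm_dvd ?_ ?_)
  · refine (squarefree_bernoulliPolyDenom n).dvd_of_forall_prime_dvd
      (Nat.lcm_ne_zero (squarefree_bernoulliPolyDiffDenom _).ne_zero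
        (squarefree_natRad _).ne_zero) fun p hp h => ?_
    rcases hp.dvd_diffDenom_succ_or_dvd_succ h with h | h
    · exact h.trans (Nat.dvd_lcm_left _ _)
    · exact ((hp.dvd_natRad_iff n.succ_ne_zero).mpr h).trans (Nat.dvd_lcm_right _ _)
  · exact (squarefree_bernoulliPolyDiffDenom _).dvd_of_forall_prime_dvd h0 fun p hp h =>
      hp.dvd_bernoulliPolyDenom_of_dvd_diffDenom_succ hn h
  · exact (squarefree_natRad _).dvd_of_forall_prime_dvd h0 fun p hp h =>
      hp.dvd_bernoulliPolyDenom_of_dvd_succ ((hp.dvd_natRad_iff n.succ_ne_zero).mp h)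

/-! ### Integrality of power sums of arithmetic progressions -/

/-- Lets `B_n(x)` be recovered from the power sum at primes not dividing `m`. -/
theorem derivative_apPowerSum (m r n : ℕ) : derivative (apPowerSum m r n) =
    C ((m : ℚ) ^ n) * (Polynomial.bernoulli n).comp (X + C ((r : ℚ) / m)) := by
  have hn : (n : ℚ) + 1 ≠ 0 := by positivity
  rw [apPowerSum, derivative_C_mul, derivative_sub, derivative_C, sub_zero, derivative_comp,
    derivative_bernoulli_add_one]
  simp only [derivative_add, derivative_X, derivative_C, add_zero, one_mul]
  rw [mul_comp, show ((n : ℚ[X]) + 1) = C ((n : ℚ) + 1) by simp, C_comp, ← mul_assoc, ← C_mul,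
    div_mul_cancel₀ _ hn]

theorem hasseDeriv_bernoulli (n l : ℕ) : hasseDeriv l (Polynomial.bernoulli n) =
    C (n.choose l : ℚ) * Polynomial.bernoulli (n - l) := by
  ext i
  rw [hasseDeriv_coeff, coeff_C_mul, coeff_bernoulli, coeff_bernoulli]
  by_cases h : i + l ≤ n
  · rw [if_pos h, if_pos (by omega), show n - (i + l) = n - l - i by omega]
    have := Nat.choose_mul (n := n) (Nat.le_add_left l i)
    rw [Nat.add_sub_cancel] at this
    have : (n.choose (i + l) : ℚ) * ((i + l).choose l) = n.choose l * (n - l).choose i := by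
      exact_mod_cast this
    linear_combination (_root_.bernoulli (n - l - i)) * this
  · rw [if_neg h, mul_zero]
    split_ifs with h'
    · rw [Nat.choose_eq_zero_of_lt (by omega : n < l)]
      simp
    · simp

/-- Taylor expansion of `B_{n+1}` at `r / m`, with `n + 1` cancelled against the binomial
coefficient to leave `l + 1`. -/
theorem coeff_apPowerSum_succ (m r n l : ℕ) : (apPowerSum m r n).coeff (l + 1) =
    (m : ℚ) ^ n / ((l : ℚ) + 1) * n.choose l * (Polynomial.bernoulli (n - l)).eval ((r : ℚ) / m) := by
  have hn : (n : ℚ) + 1 ≠ 0 := by positivity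
  have hl : (l : ℚ) + 1 ≠ 0 := by positivity
  rw [apPowerSum, coeff_C_mul, coeff_sub, coeff_C, if_neg l.succ_ne_zero, sub_zero,
    ← taylor_apply, taylor_coeff, hasseDeriv_bernoulli, eval_mul, eval_C,
    Nat.add_sub_add_right]
  have : ((n : ℚ) + 1) * n.choose l = (n + 1).choose (l + 1) * ((l : ℚ) + 1) := by
    exact_mod_cast Nat.add_one_mul_choose_eq n l
  field_simp
  linear_combination -((m : ℚ) ^ n * (Polynomial.bernoulli (n - l)).eval ((r : ℚ) / m)) * this

theorem pow_mul_bernoulli_eval_div_mem_pIntegers {p m : ℕ} [hp : Fact p.Prime] (hm0 : m ≠ 0)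
    (hm : p ∣ m) (r k : ℕ) :
    (m : ℚ) ^ k * (Polynomial.bernoulli k).eval ((r : ℚ) / m) ∈ pIntegers p := by
  have hm' : (m : ℚ) ≠ 0 := by exact_mod_cast hm0
  rw [Polynomial.bernoulli, eval_finsetSum, Finset.mul_sum]
  refine sum_mem fun i hi => ?_
  have hi : i ≤ k := Nat.lt_succ_iff.mp (Finset.mem_range.mp hi)
  have hB : (m : ℚ) ^ i * _root_.bernoulli i ∈ pIntegers p := by
    rcases i with _ | i
    · simp
    · rw [pow_succ, mul_assoc]
      exact mul_mem (pow_mem (natCast_mem _ m) i)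
        (mul_mem_pIntegers_of_dvd hm (squarefree_bernoulliDenom (i + 1)))
  have e : (m : ℚ) ^ k * (monomial (k - i) (_root_.bernoulli i * k.choose i)).eval ((r : ℚ) / m)
      = ((m : ℚ) ^ i * _root_.bernoulli i) * k.choose i * (r : ℚ) ^ (k - i) := by
    rw [eval_monomial, div_pow, ← Nat.add_sub_cancel' hi, pow_add, Nat.add_sub_cancel_left]
    field_simp
  rw [e]
  exact mul_mem (mul_mem hB (natCast_mem _ _)) (pow_mem (natCast_mem _ r) _)

theorem apPowerSum_mem_pIntegralPolys_of_dvd {p m : ℕ} [Fact p.Prime] (hm0 : m ≠ 0)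
    (hm : p ∣ m) (r n : ℕ) : apPowerSum m r n ∈ pIntegralPolys p := by
  rw [mem_pIntegralPolys]
  rintro (_ | l)
  · simp [apPowerSum, coeff_zero_eq_eval_zero, eval_comp]
  · rw [coeff_apPowerSum_succ]
    by_cases hl : l ≤ n
    -- Split `m ^ n`: `m ^ l` pays for `l + 1`, and `m ^ (n - l)` for the value of `B_{n-l}` at `r /
    -- m`.
    · have e : (m : ℚ) ^ n / ((l : ℚ) + 1) * n.choose l *
          (Polynomial.bernoulli (n - l)).eval ((r : ℚ) / m) =
          (m : ℚ) ^ l / ((l : ℚ) + 1) * n.choose l *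
            ((m : ℚ) ^ (n - l) * (Polynomial.bernoulli (n - l)).eval ((r : ℚ) / m)) := by
        rw [← pow_mul_pow_sub (m : ℚ) hl]
        ring
      rw [e]
      exact mul_mem (mul_mem (pow_div_succ_mem_pIntegers hm l) (natCast_mem _ _))
        (pow_mul_bernoulli_eval_div_mem_pIntegers hm0 hm r (n - l))
    · rw [Nat.choose_eq_zero_of_lt (not_le.mp hl)]
      simp

theorem natCast_div_mem_pIntegers {p m : ℕ} [Fact p.Prime] (hm : ¬ p ∣ m) (r : ℕ) :
    (r : ℚ) / m ∈ pIntegers p := by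
  rw [div_eq_mul_inv]
  exact mul_mem (natCast_mem _ r) (inv_natCast_mem_pIntegers hm)

theorem apPowerSum_mem_pIntegralPolys_of_not_dvd {p m n : ℕ} [hp : Fact p.Prime]
    (hm : ¬ p ∣ m) (hn : 1 ≤ n) (h : ¬ p ∣ bernoulliPolyDenom n) (r : ℕ) :
    apPowerSum m r n ∈ pIntegralPolys p := by
  have hpn : ¬ p ∣ n + 1 := fun h' => h (hp.out.dvd_bernoulliPolyDenom_of_dvd_succ h')
  have hD : Polynomial.bernoulli (n + 1) - C (_root_.bernoulli (n + 1)) ∈ pIntegralPolys p :=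
    not_dvd_polyDenom_iff.mp fun h' =>
      h (hp.out.dvd_bernoulliPolyDenom_of_dvd_diffDenom_succ hn h')
  have hrm := natCast_div_mem_pIntegers hm r
  -- The constant `B_{n+1}` cancels in the difference, so only `𝔇_{n+1}` matters, not `𝔅_{n+1}`.
  have e : apPowerSum m r n = C ((m : ℚ) ^ n * ((n + 1 : ℕ) : ℚ)⁻¹) *
      ((Polynomial.bernoulli (n + 1) - C (_root_.bernoulli (n + 1))).comp (X + C ((r : ℚ) / m)) -
        C ((Polynomial.bernoulli (n + 1) - C (_root_.bernoulli (n + 1))).eval ((r : ℚ) / m))) := by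
    rw [apPowerSum, div_eq_mul_inv]
    push_cast
    simp
  rw [e]
  exact mul_mem (C_mem_pIntegralPolys (mul_mem (pow_mem (natCast_mem _ m) n)
      (inv_natCast_mem_pIntegers hpn)))
    (sub_mem (comp_mem_pIntegralPolys hD (add_mem X_mem_pIntegralPolys (C_mem_pIntegralPolys hrm)))
      (C_mem_pIntegralPolys (eval_mem_pIntegers hD hrm)))

theorem not_dvd_bernoulliPolyDenom_of_apPowerSum_mem {p m r n : ℕ} [hp : Fact p.Prime]
    (hm0 : m ≠ 0) (hm : ¬ p ∣ m) (h : apPowerSum m r n ∈ pIntegralPolys p) :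
    ¬ p ∣ bernoulliPolyDenom n := by
  have hm' : (m : ℚ) ^ n ≠ 0 := pow_ne_zero _ (by exact_mod_cast hm0)
  rw [bernoulliPolyDenom, not_dvd_polyDenom_iff]
  have e : Polynomial.bernoulli n = C (((m : ℚ)⁻¹) ^ n) *
      (derivative (apPowerSum m r n)).comp (X - C ((r : ℚ) / m)) := by
    rw [derivative_apPowerSum, mul_comp, C_comp, comp_assoc, ← mul_assoc, ← C_mul, inv_pow,
      inv_mul_cancel₀ hm']
    simp
  rw [e]
  exact mul_mem (C_mem_pIntegralPolys (pow_mem (inv_natCast_mem_pIntegers hm) n))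
    (comp_mem_pIntegralPolys (derivative_mem_pIntegralPolys h)
      (sub_mem X_mem_pIntegralPolys (C_mem_pIntegralPolys (natCast_div_mem_pIntegers hm r))))

theorem hasIntCoeffs_apPowerSum_iff {m n : ℕ} (r : ℕ) (hm : 1 ≤ m) (hn : 1 ≤ n) :
    HasIntCoeffs (apPowerSum m r n) ↔ bernoulliPolyDenom n ∣ m := by
  have hm0 : m ≠ 0 := by omega
  constructor
  · intro h
    refine (squarefree_bernoulliPolyDenom n).dvd_of_forall_prime_dvd hm0 fun p hp hpd => ?_
    have : Fact p.Prime := ⟨hp⟩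
    by_contra hpm
    exact not_dvd_bernoulliPolyDenom_of_apPowerSum_mem hm0 hpm (h.mem_pIntegralPolys p) hpd
  · intro h
    refine hasIntCoeffs_of_forall_prime fun p _ => ?_
    by_cases hpm : p ∣ m
    · exact apPowerSum_mem_pIntegralPolys_of_dvd hm0 hpm r n
    · exact apPowerSum_mem_pIntegralPolys_of_not_dvd hpm hn (fun h' => hpm (h'.trans h)) r

theorem theorem3 (n : ℕ) (hn : 1 ≤ n) :
    (∀ m r : ℕ, 1 ≤ m → (HasIntCoeffs (apPowerSum m r n) ↔ bernoulliPolyDenom n ∣ m)) ∧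
    bernoulliPolyDenom n = Nat.lcm (bernoulliPolyDiffDenom n) (bernoulliDenom n) ∧
    bernoulliPolyDenom n = Nat.lcm (bernoulliPolyDiffDenom (n + 1)) (natRad (n + 1)) :=
  ⟨fun _ r hm => hasIntCoeffs_apPowerSum_iff r hm hn,
    bernoulliPolyDenom_eq_lcm_bernoulliDenom n, bernoulliPolyDenom_eq_lcm_natRad hn⟩
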